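/- **Vocabulary and language.** Fix a vocabulary $(\mathsf V,\mathsf{Pred},\mathsf{ar})$ where $\mathsf V$ is a countably infinite set of variables and, for every $n\in\omega$, there are exactly $\aleph_0$ predicate symbols of arity $n$. Formulas of $\mathcal L^{\preceq}$ are given by $$\varphi ::= P\vec x \mid D_Xy \mid \neg\varphi \mid \varphi\wedge\varphi \mid [\![X,Y,Z]\!]\varphi ,$$ with $P\in\mathsf{Pred}$, $\vec x\in\mathsf V^{\mathsf{ar}(P)}$, $y\in\mathsf V$ and $X,Y,Z\subseteq\mathsf V$ finite. $\vee,\to,\top,\bot$ are the usual abbreviations, $\langle\!\langle X,Y,Z\rangle\!\rangle\varphi:=\neg[\![X,Y,Z]\!]\neg\varphi$, and $D_XY:=\bigwedge_{y\in Y}D_Xy$ for finite $Y$. **RPD-models.** An RPD-model is $(W,\sim,\le,V)$ where $W\ne\emptyset$; for each $x\in\mathsf V$, $\sim_x$ is an equivalence relation and $\le_x$ a pre-order on $W$; and $V(P\vec x)\subseteq W$ for all $P\vec x$, such that whenever $w\sim_{x}u$ for every $x$ in $\vec x$, $w\in V(P\vec x)$ iff $u\in V(P\vec x)$. Let $w<_xu$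 iff $w\le_xu$ and not $u\le_xw$, and $R(X,Y,Z)=\bigcap_{x\in X}\sim_x\cap\bigcap_{y\in Y}\le_y\cap\bigcap_{z\in Z}<_z$ (the empty intersection being $W\times W$). Truth at $w$: $P\vec x$ iff $w\in V(P\vec x)$; $D_Xy$ iff $w\sim_yv$ for all $v$ with $w\sim_xv$ for every $x\in X$; $[\![X,Y,Z]\!]\varphi$ iff $\varphi$ is true at all $v$ with $w\,R(X,Y,Z)\,v$; Booleans as usual. **PD-models.** A PD-model is $(O,I,A,\preceq)$ where $O\neq\emptyset$, $I(P)\subseteq O^{\mathsf{ar}(P)}$, $A\subseteq O^{\mathsf V}$, and $\preceq_x$ is a pre-order on $A$ for each $x\in\mathsf V$. Let $a\prec_xb$ iff $a\preceq_xb$ and not $b\preceq_xa$. Truth at $a\in A$: $P\vec x$ iff $a(\vec x)\in I(P)$; $D_Xy$ iff $a(y)=b(y)$ for all $b\in A$ agreeing with $a$ on $X$; $[\![X,Y,Z]\!]\varphi$ iff $\varphi$ is true at all $b\in A$ that agree with $a$ on $X$ and satisfy $a\preceq_yb$ for all $y\in Y$ and $a\prec_zb$ for all $z\in Z$; Booleans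 as usual. **Calculus.** $\mathsf C_{\mathrm{LPFD}}$ has as axioms all instances of classical propositional tautologies and the following, with the rules modus ponens and necessitation (from $\varphi$ infer $[\![X,Y,Z]\!]\varphi$): - (K) $[\![X,Y,Z]\!](\varphi\to\psi)\to([\![X,Y,Z]\!]\varphi\to[\![X,Y,Z]\!]\psi)$; - (Ord,a) $[\![X,Y,\varnothing]\!]\varphi\to\varphi$; - (Ord,b) $\langle\!\langle X,Y,Z\rangle\!\rangle\langle\!\langle X',Y',Z'\rangle\!\rangle\varphi\to\langle\!\langle X\cap X',Y\cap Y',(Z\cap Y')\cup(Z\cap Z')\cup(Y\cap Z')\rangle\!\rangle\varphi$; - (Ord,c) $[\![X,Y,Z]\!]\varphi\to[\![X',Y',Z']\!]\varphi$ if $X\subseteq X'$, $Y\subseteq Y'$, $Z\subseteq Z'$; - (Ord,d) $\langle\!\langle X,Y,Z\rangle\!\rangle\varphi\to\langle\!\langle X,Y\cup Z,Z\rangle\!\rangle\varphi$; - (Ord,e) $(\varphi\wedge\langle\!\langle X,Y,Z\rangle\!\rangle\psi)\to\bigl(\langle\!\langle X,Y,Z\rangle\!\rangle(\psi\wedge\langle\!\langle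 X,Y,\varnothing\rangle\!\rangle\varphi)\vee\bigvee_{y\in Y}\langle\!\langle X,Y,Z\cup\{y\}\rangle\!\rangle\psi\bigr)$; - (Dep,a) $D_XX$; - (Dep,b) $\varphi\to[\![X,\varnothing,\varnothing]\!]\varphi$ if $\varphi$ is $P\vec x$ with all variables of $\vec x$ in $X$, or $\varphi$ is $D_Yz$ with $Y\subseteq X$; - (Dep,c) $(D_XS\wedge D_ST)\to D_XT$; - (Dep,d) $(D_XS\wedge[\![S,Y,Z]\!]\varphi)\to[\![X,Y,Z]\!]\varphi$. Write $\Gamma\vdash\varphi$ if $\gamma_1\wedge\dots\wedge\gamma_n\to\varphi$ is a theorem of $\mathsf C_{\mathrm{LPFD}}$ for some $n\ge0$ and $\gamma_1,\dots,\gamma_n\in\Gamma$. A set $\Gamma$ is consistent if $\Gamma\nvdash\bot$. **Theorem (strong completeness of $\mathsf C_{\mathrm{LPFD}}$).** Let $\Gamma\subseteq\mathcal L^{\preceq}$ be consistent. Then $\Gamma$ is satisfiable: there are an RPD-model and a point of it at which all formulas of $\Gamma$ are true. If moreover some variable of $\mathsf V$ occurs in no formula of $\Gamma$ (in particular, if $\Gamma$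 is finite), then there are also a PD-model and an assignment $a\in A$ at which all formulas of $\Gamma$ are true. -/

import Mathlib

namespace LPFD

universe u v w

/-- A relational vocabulary `(V, Pred, ar)`: countably infinitely many variables and, for every
`n`, countably infinitely many predicate symbols of arity `n`. -/
structure Vocabulary where
  Var : Type u
  Pred : Type v
  ar : Pred → ℕ
  var_card : Cardinal.mk Var = Cardinal.aleph0
  pred_card : ∀ n : ℕ, Cardinal.mk {P : Pred // ar P = n} = Cardinal.aleph0

theorem Vocabulary.nonempty_var (L : Vocabulary.{u, v}) : Nonempty L.Var := by
  have : Infinite L.Var := Cardinal.infinite_iff.mpr L.var_card.ge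
  infer_instance

/-- The formulas `P x₁ … xₙ`, `D_X y`, `¬φ`, `φ ∧ ψ`, `[[X,Y,Z]]φ`, where `X, Y, Z` are finite
sets of variables. -/
inductive Formula (L : Vocabulary.{u, v}) : Type (max u v) where
  | pred (P : L.Pred) (x : Fin (L.ar P) → L.Var) : Formula L
  | dep (X : Finset L.Var) (y : L.Var) : Formula L
  | neg (φ : Formula L) : Formula L
  | and (φ ψ : Formula L) : Formula L
  | box (X Y Z : Finset L.Var) (φ : Formula L) : Formula L

namespace Formula

variable {L : Vocabulary.{u, v}}

/-- `φ ∨ ψ := ¬(¬φ ∧ ¬ψ)` -/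
def or (φ ψ : Formula L) : Formula L := neg (and (neg φ) (neg ψ))

/-- `φ → ψ := ¬(φ ∧ ¬ψ)` -/
def imp (φ ψ : Formula L) : Formula L := neg (and φ (neg ψ))

/-- `⟨⟨X,Y,Z⟩⟩φ := ¬[[X,Y,Z]]¬φ` -/
def dia (X Y Z : Finset L.Var) (φ : Formula L) : Formula L := neg (box X Y Z (neg φ))

/-- `⊥`: a fixed contradiction `D_∅ x ∧ ¬D_∅ x`. -/
noncomputable def bot : Formula L :=
  and (dep ∅ (Classical.choice L.nonempty_var)) (neg (dep ∅ (Classical.choice L.nonempty_var)))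

/-- `⊤ := ¬⊥` -/
noncomputable def top : Formula L := neg bot

/-- Finite conjunctions; the empty one is `⊤`. -/
noncomputable def bigAnd (l : List (Formula L)) : Formula L := l.foldr and top

/-- Finite disjunctions; the empty one is `⊥`. -/
noncomputable def bigOr (l : List (Formula L)) : Formula L := l.foldr or bot

/-- `D_X Y := ⋀_{y ∈ Y} D_X y` -/
noncomputable def depSet (X Y : Finset L.Var) : Formula L := bigAnd (Y.toList.map (dep X))

/-- The variable `z` occurs in the formula, in an atom or in an index of an operator. -/
def Occurs (z : L.Var) : Formula L → Prop
  | pred _ x => ∃ i, x i = z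
  | dep X y => z ∈ X ∨ z = y
  | neg φ => Occurs z φ
  | and φ ψ => Occurs z φ ∨ Occurs z ψ
  | box X Y Z φ => z ∈ X ∨ z ∈ Y ∨ z ∈ Z ∨ Occurs z φ

/-- (Instances of) classical propositional tautologies: formulas true under every two-valued
valuation of formulas that respects `¬` and `∧`. -/
def IsTautology (φ : Formula L) : Prop :=
  ∀ val : Formula L → Prop,
    (∀ ψ, val (neg ψ) ↔ ¬ val ψ) → (∀ ψ χ, val (and ψ χ) ↔ (val ψ ∧ val χ)) → val φ

/-- `Atom(X) = {P x₁ … xₙ : {x₁, …, xₙ} ⊆ X} ∪ {D_Y z : Y ⊆ X}` -/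
def Atom (X : Finset L.Var) : Set (Formula L) :=
  {φ | ∃ (P : L.Pred) (x : Fin (L.ar P) → L.Var), (∀ i, x i ∈ X) ∧ φ = pred P x} ∪
    {φ | ∃ (Y : Finset L.Var) (z : L.Var), Y ⊆ X ∧ φ = dep Y z}

end Formula

open Formula

open scoped Classical in
/-- The theorems of the Hilbert calculus `C_LPFD`. -/
inductive Provable {L : Vocabulary.{u, v}} : Formula L → Prop where
  | taut (φ : Formula L) : IsTautology φ → Provable φ
  | mp (φ ψ : Formula L) : Provable (imp φ ψ) → Provable φ → Provable ψ
  | nec (X Y Z : Finset L.Var) (φ : Formula L) : Provable φ → Provable (box X Y Z φ)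
  | axK (X Y Z : Finset L.Var) (φ ψ : Formula L) :
      Provable (imp (box X Y Z (imp φ ψ)) (imp (box X Y Z φ) (box X Y Z ψ)))
  | ordA (X Y : Finset L.Var) (φ : Formula L) :
      Provable (imp (box X Y ∅ φ) φ)
  | ordB (X Y Z X' Y' Z' : Finset L.Var) (φ : Formula L) :
      Provable (imp (dia X Y Z (dia X' Y' Z' φ))
        (dia (X ∩ X') (Y ∩ Y') ((Z ∩ Y') ∪ (Z ∩ Z') ∪ (Y ∩ Z')) φ))
  | ordC (X Y Z X' Y' Z' : Finset L.Var) (φ : Formula L) :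
      X ⊆ X' → Y ⊆ Y' → Z ⊆ Z' → Provable (imp (box X Y Z φ) (box X' Y' Z' φ))
  | ordD (X Y Z : Finset L.Var) (φ : Formula L) :
      Provable (imp (dia X Y Z φ) (dia X (Y ∪ Z) Z φ))
  | ordE (X Y Z : Finset L.Var) (φ ψ : Formula L) :
      Provable (imp (and φ (dia X Y Z ψ))
        (or (dia X Y Z (and ψ (dia X Y ∅ φ)))
          (bigOr (Y.toList.map (fun y => dia X Y (Z ∪ {y}) ψ)))))
  | depA (X : Finset L.Var) : Provable (depSet X X)
  | depB (X : Finset L.Var) (φ : Formula L) :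
      φ ∈ Atom X → Provable (imp φ (box X ∅ ∅ φ))
  | depC (X S T : Finset L.Var) :
      Provable (imp (and (depSet X S) (depSet S T)) (depSet X T))
  | depD (X S Y Z : Finset L.Var) (φ : Formula L) :
      Provable (imp (and (depSet X S) (box S Y Z φ)) (box X Y Z φ))

/-- `Γ ⊢ φ`: some finite conjunction of members of `Γ` provably implies `φ`. -/
def Derives {L : Vocabulary.{u, v}} (Γ : Set (Formula L)) (φ : Formula L) : Prop :=
  ∃ l : List (Formula L), (∀ ψ ∈ l, ψ ∈ Γ) ∧ Provable (imp (bigAnd l) φ)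

/-- `Γ` is consistent if `Γ ⊬ ⊥`. -/
def Consistent {L : Vocabulary.{u, v}} (Γ : Set (Formula L)) : Prop := ¬ Derives Γ bot

/-- Relational preference dependence models. -/
structure RPDModel (L : Vocabulary.{u, v}) where
  W : Type w
  nonempty : Nonempty W
  sim : L.Var → W → W → Prop
  sim_equiv : ∀ x, Equivalence (sim x)
  le : L.Var → W → W → Prop
  le_refl : ∀ x a, le x a a
  le_trans : ∀ x a b c, le x a b → le x b c → le x a c
  val : (P : L.Pred) → (Fin (L.ar P) → L.Var) → Set W
  val_iff : ∀ (P : L.Pred) (x : Fin (L.ar P) → L.Var) (a b : W),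
    (∀ i, sim (x i) a b) → (a ∈ val P x ↔ b ∈ val P x)

namespace RPDModel

variable {L : Vocabulary.{u, v}} (M : RPDModel.{u, v, w} L)

/-- `a <_x b` -/
def lt (x : L.Var) (a b : M.W) : Prop := M.le x a b ∧ ¬ M.le x b a

/-- `R(X,Y,Z)`: the intersection of `∼_x`, `≤_y`, `<_z` for `x ∈ X`, `y ∈ Y`, `z ∈ Z`. -/
def R (X Y Z : Finset L.Var) (a b : M.W) : Prop :=
  (∀ x ∈ X, M.sim x a b) ∧ (∀ y ∈ Y, M.le y a b) ∧ (∀ z ∈ Z, M.lt z a b)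

/-- Truth at a point. -/
def Sat : M.W → Formula L → Prop
  | a, .pred P x => a ∈ M.val P x
  | a, .dep X y => ∀ b : M.W, (∀ x ∈ X, M.sim x a b) → M.sim y a b
  | a, .neg φ => ¬ Sat a φ
  | a, .and φ ψ => Sat a φ ∧ Sat a ψ
  | a, .box X Y Z φ => ∀ b : M.W, M.R X Y Z a b → Sat b φ

end RPDModel

/-- Preference dependence models: a first-order structure `(O, I)`, a set `A` of assignments
(strategy profiles) and a pre-order on `A` for each variable. -/
structure PDModel (L : Vocabulary.{u, v}) where
  O : Type w
  nonempty : Nonempty O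
  I : (P : L.Pred) → Set (Fin (L.ar P) → O)
  A : Set (L.Var → O)
  le : L.Var → A → A → Prop
  le_refl : ∀ x a, le x a a
  le_trans : ∀ x a b c, le x a b → le x b c → le x a c

namespace PDModel

variable {L : Vocabulary.{u, v}} (M : PDModel.{u, v, w} L)

/-- `a ≺_x b` -/
def lt (x : L.Var) (a b : M.A) : Prop := M.le x a b ∧ ¬ M.le x b a

/-- Truth at an admissible assignment. -/
def Sat : M.A → Formula L → Prop
  | a, .pred P x => (fun i => a.1 (x i)) ∈ M.I P
  | a, .dep X y => ∀ b : M.A, (∀ x ∈ X, a.1 x = b.1 x) → a.1 y = b.1 y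
  | a, .neg φ => ¬ Sat a φ
  | a, .and φ ψ => Sat a φ ∧ Sat a ψ
  | a, .box X Y Z φ => ∀ b : M.A,
      (∀ x ∈ X, a.1 x = b.1 x) → (∀ y ∈ Y, M.le y a b) → (∀ z ∈ Z, M.lt z a b) → Sat b φ

end PDModel

/-- All formulas of `Γ` are true together at some point of some RPD-model. -/
def SatisfiableRPD {L : Vocabulary.{u, v}} (Γ : Set (Formula L)) : Prop :=
  ∃ (M : RPDModel.{u, v, max u v} L) (a : M.W), ∀ φ ∈ Γ, M.Sat a φ

/-- All formulas of `Γ` are true together at some assignment of some PD-model. -/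
def SatisfiablePD {L : Vocabulary.{u, v}} (Γ : Set (Formula L)) : Prop :=
  ∃ (M : PDModel.{u, v, max u v} L) (a : M.A), ∀ φ ∈ Γ, M.Sat a φ

end LPFD

/-!
Strong completeness of the calculus of preference and functional dependence.

Consistent sets extend to maximal consistent sets (`Consistent.exists_isMCS`), between which
`Canon X Y Z` is the usual canonical relation of the operator `[[X,Y,Z]]`. These relations satisfy
the closure conditions which the axioms express, but `Canon X Y Z` need not be the intersection of
relations attached to the single variables, nor need strict preferences be irreflexive. Both
defects disappear on a tree. Fix a maximal consistent set `w₀`; the points of the model are the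
finite paths from `w₀` whose edges carry an index `(X, Y, Z)` with `Y` and `Z` disjoint, such that
`Canon X Y Z` holds along the edge and `Canon X Y ∅` holds against it. An edge is a `∼_x`-edge if
`D_X x` is true at its end; it may be traversed for `≤_y` downwards if `y ∈ Y ∪ Z` and upwards if
`y ∈ Y`; and `∼_x`, `≤_y` relate the points joined by a walk along permitted edges.

The longest common initial part of two paths decides all these relations at the same time
(`exists_decomposition`). Hence `R(X,Y,Z)` in the tree is witnessed by a single walk, along which
the canonical relations compose to `Canon X Y Z` (`canon_of_R`). Conversely, a true
`⟨⟨X,Y,Z⟩⟩ψ` is witnessed by a child (`exists_edge`): moving as many elements of `Y` into `Z` as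
possible refutes the second alternative of (Ord,e), and the first one says exactly that the edge
can be walked back along the remaining elements of `Y`. A false `D_X y` is refuted by a child with
index `(X, ∅, ∅)` carrying the same maximal consistent set. This gives the truth lemma
`sat_treeModel`.

For PD-models, a variable `z` that occurs nowhere in the set can have `∼_z` replaced by equality
(`RPDModel.sat_separate`). The points are then determined by their `∼_x`-classes, so that they may
be identified with the assignments sending `x` to the `∼_x`-class of the point
(`RPDModel.sat_toPD`).
-/

namespace LPFD

universe u v w

open Formula

variable {L : Vocabulary.{u, v}}

/-! ### Propositional reasoning -/

/-- A two-valued valuation of formulas that respects `¬` and `∧`. -/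
structure IsValuation (val : Formula L → Prop) : Prop where
  neg_iff : ∀ ψ, val (.neg ψ) ↔ ¬ val ψ
  and_iff : ∀ ψ χ, val (.and ψ χ) ↔ (val ψ ∧ val χ)

namespace IsValuation

variable {val : Formula L → Prop}

theorem imp_iff (h : IsValuation val) (φ ψ : Formula L) : val (.imp φ ψ) ↔ (val φ → val ψ) := by
  simp [Formula.imp, h.neg_iff, h.and_iff]

theorem or_iff (h : IsValuation val) (φ ψ : Formula L) : val (.or φ ψ) ↔ (val φ ∨ val ψ) := by
  simp only [Formula.or, h.neg_iff, h.and_iff]; tauto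

theorem not_bot (h : IsValuation val) : ¬ val bot := by
  simp [bot, h.neg_iff, h.and_iff]

theorem bigAnd_iff (h : IsValuation val) (l : List (Formula L)) :
    val (bigAnd l) ↔ ∀ φ ∈ l, val φ := by
  induction l with
  | nil => simpa [bigAnd, top, h.neg_iff] using h.not_bot
  | cons a l ih =>
    have : bigAnd (a :: l) = .and a (bigAnd l) := rfl
    simp [this, h.and_iff, ih]

theorem bigOr_iff (h : IsValuation val) (l : List (Formula L)) : val (bigOr l) ↔ ∃ φ ∈ l, val φ := by
  induction l with
  | nil => simpa [bigOr] using h.not_bot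
  | cons a l ih =>
    have : bigOr (a :: l) = .or a (bigOr l) := rfl
    simp [this, h.or_iff, ih]

theorem depSet_iff (h : IsValuation val) (X Y : Finset L.Var) :
    val (depSet X Y) ↔ ∀ y ∈ Y, val (.dep X y) := by
  simp [depSet, h.bigAnd_iff]

end IsValuation

theorem Provable.of_valuation {φ : Formula L}
    (h : ∀ val : Formula L → Prop, IsValuation val → val φ) : Provable φ :=
  .taut φ fun val hn ha => h val ⟨hn, ha⟩

/-- Theorems are closed under propositional consequence. -/
theorem Provable.of_entails {φ ψ : Formula L} (hφ : Provable φ)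
    (h : ∀ val : Formula L → Prop, IsValuation val → val φ → val ψ) : Provable ψ :=
  .mp φ ψ (.of_valuation fun val hv => (hv.imp_iff φ ψ).2 (h val hv)) hφ

theorem Provable.of_entails₂ {φ χ ψ : Formula L} (hφ : Provable φ) (hχ : Provable χ)
    (h : ∀ val : Formula L → Prop, IsValuation val → val φ → val χ → val ψ) : Provable ψ :=
  .mp χ ψ (hφ.of_entails fun val hv h₁ => (hv.imp_iff χ ψ).2 (h val hv h₁)) hχ

theorem Derives.imp_of_insert {Γ : Set (Formula L)} {φ ψ : Formula L}
    (h : Derives (insert ψ Γ) φ) : Derives Γ (.imp ψ φ) := by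
  classical
  obtain ⟨l, hl, hp⟩ := h
  refine ⟨l.filter (· ≠ ψ), fun χ hχ => ?_, hp.of_entails fun val hv h => ?_⟩
  · have := List.mem_filter.1 hχ
    exact (hl χ this.1).resolve_left (by simpa using this.2)
  · simp only [hv.imp_iff, hv.bigAnd_iff, List.mem_filter] at h ⊢
    intro h₁ h₂
    refine h fun χ hχ => ?_
    by_cases e : χ = ψ
    · exact e ▸ h₂
    · exact h₁ χ ⟨hχ, by simpa using e⟩

theorem Derives.of_entails₂ {Γ : Set (Formula L)} {φ χ ψ : Formula L} (hφ : Derives Γ φ)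
    (hχ : Derives Γ χ)
    (h : ∀ val : Formula L → Prop, IsValuation val → val φ → val χ → val ψ) : Derives Γ ψ := by
  obtain ⟨l, hl, hp⟩ := hφ
  obtain ⟨m, hm, hq⟩ := hχ
  refine ⟨l ++ m, fun θ hθ => (List.mem_append.1 hθ).elim (hl θ) (hm θ),
    hp.of_entails₂ hq fun val hv h₁ h₂ => ?_⟩
  simp only [hv.imp_iff, hv.bigAnd_iff, List.mem_append] at h₁ h₂ ⊢
  exact fun H => h val hv (h₁ fun θ hθ => H θ (.inl hθ)) (h₂ fun θ hθ => H θ (.inr hθ))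

theorem Derives.of_mem {Γ : Set (Formula L)} {φ : Formula L} (h : φ ∈ Γ) : Derives Γ φ :=
  ⟨[φ], by simpa using h, .of_valuation fun val hv => by simp [hv.imp_iff, hv.bigAnd_iff]⟩

theorem Derives.of_provable {Γ : Set (Formula L)} {φ : Formula L} (h : Provable φ) :
    Derives Γ φ :=
  ⟨[], by simp, h.of_entails fun val hv h => by simp [hv.imp_iff, h]⟩

/-! ### Maximal consistent sets -/

/-- Maximal consistent sets, in the form in which they are used: sets that contain all theorems and
are the truth set of a valuation. -/
structure IsMCS (S : Set (Formula L)) : Prop where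
  valuation : IsValuation (· ∈ S)
  provable : ∀ {φ}, Provable φ → φ ∈ S

/-- Lindenbaum's lemma. -/
theorem Consistent.exists_isMCS {Γ : Set (Formula L)} (hΓ : Consistent Γ) :
    ∃ S, Γ ⊆ S ∧ IsMCS S := by
  obtain ⟨S, hΓS, hS⟩ := zorn_subset_nonempty {S : Set (Formula L) | Consistent S}
    (fun c hc hchain hne => by
      refine ⟨⋃₀ c, ?_, fun s hs => Set.subset_sUnion_of_mem hs⟩
      rintro ⟨l, hl, hp⟩
      have : ∃ s ∈ c, ∀ ψ ∈ l, ψ ∈ s := by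
        clear hp
        induction l with
        | nil => exact ⟨hne.some, hne.some_mem, by simp⟩
        | cons a l ih =>
          obtain ⟨s, hs, hls⟩ := ih fun ψ hψ => hl ψ (List.mem_cons_of_mem _ hψ)
          obtain ⟨t, ht, hat⟩ := hl a List.mem_cons_self
          rcases hchain.total hs ht with h | h
          · exact ⟨t, ht, List.forall_mem_cons.2 ⟨hat, fun ψ hψ => h (hls ψ hψ)⟩⟩
          · exact ⟨s, hs, List.forall_mem_cons.2 ⟨h hat, hls⟩⟩
      obtain ⟨s, hs, hls⟩ := this
      exact hc hs ⟨l, hls, hp⟩) Γ hΓ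
  have hcon : ¬ Derives S bot := hS.prop
  have key : ∀ φ, φ ∉ S → Derives S (.imp φ bot) := fun φ hφ => by
    by_contra h
    have : Consistent (insert φ S) := fun h' => h h'.imp_of_insert
    exact hφ (hS.le_of_ge this (Set.subset_insert _ _) (Set.mem_insert _ _))
  have closed : ∀ φ, Derives S φ → φ ∈ S := fun φ h => by
    by_contra hφ
    exact hcon (h.of_entails₂ (key φ hφ) fun val hv h₁ h₂ => (hv.imp_iff _ _).1 h₂ h₁)
  refine ⟨S, hΓS, ⟨fun ψ => ⟨fun h₁ h₂ => ?_, fun h => closed _ ?_⟩, fun ψ χ => ⟨fun h => ?_, ?_⟩⟩,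
    fun h => closed _ (.of_provable h)⟩
  · exact hcon ((Derives.of_mem h₁).of_entails₂ (Derives.of_mem h₂) fun val hv a b =>
      absurd b ((hv.neg_iff _).1 a))
  · exact (key ψ h).of_entails₂ (key ψ h) fun val hv a _ =>
      (hv.neg_iff _).2 fun b => hv.not_bot ((hv.imp_iff _ _).1 a b)
  · have hd := Derives.of_mem h
    exact ⟨closed _ (hd.of_entails₂ hd fun val hv a _ => ((hv.and_iff _ _).1 a).1),
      closed _ (hd.of_entails₂ hd fun val hv a _ => ((hv.and_iff _ _).1 a).2)⟩
  · rintro ⟨h₁, h₂⟩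
    exact closed _ ((Derives.of_mem h₁).of_entails₂ (Derives.of_mem h₂) fun val hv a b =>
      (hv.and_iff _ _).2 ⟨a, b⟩)

namespace IsMCS

variable {S : Set (Formula L)}

theorem mp (h : IsMCS S) {φ ψ : Formula L} (hp : Provable (.imp φ ψ)) (hφ : φ ∈ S) : ψ ∈ S :=
  (h.valuation.imp_iff φ ψ).1 (h.provable hp) hφ

theorem neg_mem (h : IsMCS S) {φ : Formula L} : Formula.neg φ ∈ S ↔ φ ∉ S :=
  h.valuation.neg_iff φ

theorem and_mem (h : IsMCS S) {φ ψ : Formula L} : Formula.and φ ψ ∈ S ↔ φ ∈ S ∧ ψ ∈ S :=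
  h.valuation.and_iff φ ψ

theorem box_mono (h : IsMCS S) {X Y Z : Finset L.Var} {φ ψ : Formula L}
    (hp : Provable (.imp φ ψ)) (hφ : Formula.box X Y Z φ ∈ S) : Formula.box X Y Z ψ ∈ S :=
  (h.valuation.imp_iff _ _).1 (h.mp (.axK X Y Z φ ψ) (h.provable (.nec X Y Z _ hp))) hφ

theorem dia_mem (h : IsMCS S) {X Y Z : Finset L.Var} {φ : Formula L} :
    Formula.dia X Y Z φ ∈ S ↔ Formula.box X Y Z (.neg φ) ∉ S :=
  h.neg_mem

theorem dia_neg_mem (h : IsMCS S) {X Y Z : Finset L.Var} {φ : Formula L} :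
    Formula.dia X Y Z (.neg φ) ∈ S ↔ Formula.box X Y Z φ ∉ S := by
  refine h.dia_mem.trans (not_congr ⟨h.box_mono ?_, h.box_mono ?_⟩) <;>
  exact .of_valuation fun val hv => by simp [hv.imp_iff, hv.neg_iff]

theorem box_bigAnd (h : IsMCS S) {X Y Z : Finset L.Var} (l : List (Formula L))
    (hl : ∀ φ ∈ l, Formula.box X Y Z φ ∈ S) : Formula.box X Y Z (bigAnd l) ∈ S := by
  induction l with
  | nil =>
    exact h.provable (.nec X Y Z _ (.of_valuation fun val hv => (hv.bigAnd_iff []).2 (by simp)))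
  | cons a l ih =>
    have h₁ : Formula.box X Y Z (.imp (bigAnd l) (bigAnd (a :: l))) ∈ S :=
      h.box_mono (.of_valuation fun val hv => by simp +contextual [hv.imp_iff, hv.bigAnd_iff])
        (hl a List.mem_cons_self)
    exact (h.valuation.imp_iff _ _).1 (h.mp (.axK X Y Z _ _) h₁)
      (ih fun φ hφ => hl φ (List.mem_cons_of_mem _ hφ))

end IsMCS

theorem Provable.dia_mono {X Y Z : Finset L.Var} {φ ψ : Formula L} (h : Provable (.imp φ ψ)) :
    Provable (.imp (.dia X Y Z φ) (.dia X Y Z ψ)) := by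
  have h₁ : Provable (.imp (.neg ψ) (.neg φ)) := h.of_entails fun val hv h => by
    simp only [hv.imp_iff, hv.neg_iff] at h ⊢; tauto
  exact (Provable.mp _ _ (.axK X Y Z _ _) (.nec X Y Z _ h₁)).of_entails fun val hv h => by
    simp only [hv.imp_iff, hv.neg_iff, Formula.dia] at h ⊢; tauto

/-! ### Canonical relations -/

/-- The canonical relation of the operator `[[X,Y,Z]]`. -/
def Canon (X Y Z : Finset L.Var) (S T : Set (Formula L)) : Prop :=
  ∀ φ, Formula.box X Y Z φ ∈ S → φ ∈ T

section Canon

variable {S T U : Set (Formula L)} {X Y Z X' Y' Z' : Finset L.Var}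

theorem canon_iff_dia (hS : IsMCS S) (hT : IsMCS T) :
    Canon X Y Z S T ↔ ∀ φ ∈ T, Formula.dia X Y Z φ ∈ S := by
  refine ⟨fun h φ hφ => hS.dia_mem.2 fun h' => hT.neg_mem.1 (h _ h') hφ, fun h φ hφ => ?_⟩
  by_contra h'
  exact hS.dia_neg_mem.1 (h _ (hT.neg_mem.2 h')) hφ

theorem Canon.mono (hS : IsMCS S) (h : Canon X' Y' Z' S T) (hX : X ⊆ X') (hY : Y ⊆ Y')
    (hZ : Z ⊆ Z') : Canon X Y Z S T :=
  fun φ hφ => h φ (hS.mp (.ordC _ _ _ _ _ _ φ hX hY hZ) hφ)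

theorem canon_refl (hS : IsMCS S) : Canon X Y ∅ S S :=
  fun φ hφ => hS.mp (.ordA X Y φ) hφ

open scoped Classical in
/-- Transitivity, when all conditions concern the same `X` and `Y`: the strict steps add up. -/
theorem Canon.trans (hS : IsMCS S) (hT : IsMCS T) (hU : IsMCS U) (hZ : Z ⊆ Y) (hZ' : Z' ⊆ Y)
    (h₁ : Canon X Y Z S T) (h₂ : Canon X Y Z' T U) : Canon X Y (Z ∪ Z') S U := by
  refine Canon.mono (X' := X ∩ X) (Y' := Y ∩ Y) (Z' := (Z ∩ Y) ∪ (Z ∩ Z') ∪ (Y ∩ Z')) hS ?_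
    (by simp) (by simp) ?_
  · exact (canon_iff_dia hS hU).2 fun φ hφ => hS.mp (.ordB _ _ _ _ _ _ φ)
      ((canon_iff_dia hS hT).1 h₁ _ ((canon_iff_dia hT hU).1 h₂ φ hφ))
  · intro z hz
    have := @hZ z
    have := @hZ' z
    simp only [Finset.mem_union, Finset.mem_inter] at hz ⊢
    tauto

open scoped Classical in
theorem Canon.union_strict (hS : IsMCS S) (hT : IsMCS T) (h : Canon X Y Z S T) :
    Canon X (Y ∪ Z) Z S T :=
  (canon_iff_dia hS hT).2 fun φ hφ => hS.mp (.ordD X Y Z φ) ((canon_iff_dia hS hT).1 h φ hφ)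

theorem Canon.of_dep (hS : IsMCS S) (h : Canon X Y Z S T)
    (hD : ∀ x ∈ X', Formula.dep X x ∈ S) : Canon X' Y Z S T :=
  fun φ hφ => h φ (hS.mp (.depD X X' Y Z φ)
    (hS.and_mem.2 ⟨(hS.valuation.depSet_iff X X').2 hD, hφ⟩))

theorem Canon.atom (hS : IsMCS S) (h : Canon X Y Z S T) {φ : Formula L} (hφ : φ ∈ Atom X)
    (hφS : φ ∈ S) : φ ∈ T :=
  h φ (hS.mp (.ordC X ∅ ∅ X Y Z φ subset_rfl (Finset.empty_subset _) (Finset.empty_subset _))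
    (hS.mp (.depB X φ hφ) hφS))

theorem dep_mem_atom (X : Finset L.Var) (y : L.Var) : Formula.dep X y ∈ Atom X :=
  .inr ⟨X, y, subset_rfl, rfl⟩

theorem IsMCS.dep_self (hS : IsMCS S) : ∀ x ∈ X, Formula.dep X x ∈ S :=
  (hS.valuation.depSet_iff X X).1 (hS.provable (.depA X))

theorem IsMCS.dep_trans (hS : IsMCS S) (h : ∀ x ∈ X', Formula.dep X x ∈ S) {y : L.Var}
    (hy : Formula.dep X' y ∈ S) : Formula.dep X y ∈ S := by
  have h₂ := hS.mp (.depC X X' {y}) (hS.and_mem.2 ⟨(hS.valuation.depSet_iff X X').2 h,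
    (hS.valuation.depSet_iff X' {y}).2 (by simpa using hy)⟩)
  exact (hS.valuation.depSet_iff X {y}).1 h₂ y (by simp)

/-- The existence lemma: a set of formulas whose finite conjunctions are all possible at `S` is
contained in a canonical successor of `S`. -/
theorem exists_canon (hS : IsMCS S) {G : Set (Formula L)}
    (hG : ∀ l : List (Formula L), (∀ φ ∈ l, φ ∈ G) → Formula.dia X Y Z (bigAnd l) ∈ S) :
    ∃ T, IsMCS T ∧ G ⊆ T ∧ Canon X Y Z S T := by
  classical
  have hcon : Consistent (G ∪ {φ | Formula.box X Y Z φ ∈ S}) := by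
    rintro ⟨l, hl, hp⟩
    refine hS.dia_mem.1 (hG (l.filter (· ∈ G)) fun φ hφ => by simpa using (List.mem_filter.1 hφ).2)
      (hS.box_mono (hp.of_entails fun val hv h => ?_)
        (hS.box_bigAnd (l.filter (· ∉ G)) fun φ hφ => ?_))
    · simp only [hv.imp_iff, hv.neg_iff, hv.bigAnd_iff] at h ⊢
      refine fun h₁ h₂ => hv.not_bot (h fun φ hφ => ?_)
      by_cases e : φ ∈ G
      · exact h₂ φ (by simp [hφ, e])
      · exact h₁ φ (by simp [hφ, e])
    · have := List.mem_filter.1 hφ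
      exact (hl φ this.1).resolve_left (by simpa using this.2)
  obtain ⟨T, hT, hmcs⟩ := hcon.exists_isMCS
  exact ⟨T, hmcs, fun φ hφ => hT (.inl hφ), fun φ hφ => hT (.inr hφ)⟩

open scoped Classical in
/-- A possibility is witnessed along an edge of the tree. The weak conditions `Y' ∪ Z' = Y ∪ Z` are
kept, the strict ones may increase, and the edge can be walked back along `Y'`. -/
theorem exists_edge (hS : IsMCS S) {ψ : Formula L} (h : Formula.dia X Y Z ψ ∈ S) :
    ∃ (Y' Z' : Finset L.Var) (T : Set (Formula L)), IsMCS T ∧ Y' ∪ Z' = Y ∪ Z ∧ Z ⊆ Z' ∧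
      Disjoint Y' Z' ∧ Canon X Y' Z' S T ∧ Canon X Y' ∅ T S ∧ ψ ∈ T := by
  have dia_anti : ∀ {A B C B' C' : Finset L.Var}, B ⊆ B' → C ⊆ C' →
      Formula.dia A B' C' ψ ∈ S → Formula.dia A B C ψ ∈ S := fun hB hC h =>
    hS.dia_mem.2 fun h' => hS.dia_mem.1 h (hS.mp (.ordC _ _ _ _ _ _ _ subset_rfl hB hC) h')
  -- A largest set of strict conditions that keeps `ψ` possible.
  obtain ⟨Z', hZ', hmax⟩ := Finset.exists_max_image
    ((Y ∪ Z).powerset.filter fun Z' => Z ⊆ Z' ∧ Formula.dia X ((Y ∪ Z) \ Z') Z' ψ ∈ S)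
    Finset.card ⟨Z, by
      simp only [Finset.mem_filter, Finset.mem_powerset, subset_rfl, true_and]
      exact ⟨Finset.subset_union_right,
        dia_anti Finset.sdiff_subset subset_rfl (hS.mp (.ordD X Y Z ψ) h)⟩⟩
  simp only [Finset.mem_filter, Finset.mem_powerset] at hZ' hmax
  obtain ⟨hsub, hZZ', hdia⟩ := hZ'
  set Y' := (Y ∪ Z) \ Z' with hY'
  have back : ∀ φ ∈ S, Formula.dia X Y' Z' (.and ψ (.dia X Y' ∅ φ)) ∈ S := fun φ hφ => by
    refine ((hS.valuation.or_iff _ _).1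
      (hS.mp (.ordE X Y' Z' φ ψ) (hS.and_mem.2 ⟨hφ, hdia⟩))).resolve_right fun hor => ?_
    obtain ⟨_, hχ, hy⟩ := (hS.valuation.bigOr_iff _).1 hor
    obtain ⟨y, hyY, rfl⟩ := List.mem_map.1 hχ
    rw [Finset.mem_toList, hY', Finset.mem_sdiff] at hyY
    have := hmax (Z' ∪ {y}) ⟨Finset.union_subset hsub (by simpa using hyY.1),
      hZZ'.trans Finset.subset_union_left,
      dia_anti (Finset.sdiff_subset_sdiff subset_rfl Finset.subset_union_left) subset_rfl hy⟩
    rw [Finset.union_comm, ← Finset.insert_eq, Finset.card_insert_of_notMem hyY.2] at this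
    omega
  obtain ⟨T, hT, hGT, hST⟩ := exists_canon (X := X) (Y := Y') (Z := Z') hS
    (G := insert ψ {χ | ∃ φ ∈ S, χ = .dia X Y' ∅ φ}) (fun l hl => by
      -- Finitely many members of `S` are replaced by their conjunction.
      have : ∃ φ ∈ S, Provable (.imp (.and ψ (.dia X Y' ∅ φ)) (bigAnd l)) := by
        induction l with
        | nil =>
          exact ⟨top, hS.provable (.of_valuation fun val hv => (hv.neg_iff _).2 hv.not_bot),
            .of_valuation fun val hv => by simp [hv.imp_iff, hv.bigAnd_iff]⟩
        | cons a l ih =>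
          obtain ⟨φ, hφ, hp⟩ := ih fun φ hφ => hl φ (List.mem_cons_of_mem _ hφ)
          rcases hl a List.mem_cons_self with rfl | ⟨χ, hχ, rfl⟩
          · refine ⟨φ, hφ, hp.of_entails fun val hv h => ?_⟩
            simp only [hv.imp_iff, hv.and_iff, hv.bigAnd_iff, List.forall_mem_cons] at h ⊢
            exact fun h' => ⟨h'.1, h h'⟩
          · refine ⟨.and φ χ, hS.and_mem.2 ⟨hφ, hχ⟩, ?_⟩
            have h₁ : Provable (.imp (.dia X Y' ∅ (.and φ χ)) (.dia X Y' ∅ φ)) := .dia_mono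
              (.of_valuation fun val hv => by simp +contextual [hv.imp_iff, hv.and_iff])
            have h₂ : Provable (.imp (.dia X Y' ∅ (.and φ χ)) (.dia X Y' ∅ χ)) := .dia_mono
              (.of_valuation fun val hv => by simp [hv.imp_iff, hv.and_iff])
            refine Provable.mp _ _ (h₁.of_entails₂ hp fun val hv a b => ?_) h₂
            simp only [hv.imp_iff, hv.and_iff, hv.bigAnd_iff, List.forall_mem_cons] at a b ⊢
            exact fun c d => ⟨c d.2, b ⟨d.1, a d.2⟩⟩
      obtain ⟨φ, hφ, hp⟩ := this
      exact hS.mp (.dia_mono hp) (back φ hφ))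
  refine ⟨Y', Z', T, hT, Finset.sdiff_union_of_subset hsub, hZZ', Finset.sdiff_disjoint, hST,
    (canon_iff_dia hT hS).2 fun φ hφ => hGT (.inr ⟨φ, hφ, rfl⟩), hGT (.inl rfl)⟩

end Canon

/-! ### Walks in a tree of lists -/

section Reach

variable {α : Type w} {p q : α → Prop} {a b c : List α}

/-- Lists form a tree in which the children of `l` are the lists `s :: l`; the edge above `s :: l`
is labelled `s`. `Reach p q a b` holds if one gets from `a` to `b` by going up along edges whose
labels satisfy `p` and then down along edges whose labels satisfy `q`. -/
def Reach (p q : α → Prop) (a b : List α) : Prop :=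
  ∃ c l r, a = l ++ c ∧ b = r ++ c ∧ (∀ s ∈ l, p s) ∧ ∀ s ∈ r, q s

theorem Reach.refl : Reach p q a a :=
  ⟨a, [], [], rfl, rfl, by simp, by simp⟩

theorem Reach.symm (h : Reach p q a b) : Reach q p b a := by
  obtain ⟨c, l, r, ha, hb, hl, hr⟩ := h
  exact ⟨c, r, l, hb, ha, hr, hl⟩

theorem Reach.trans (h₁ : Reach p q a b) (h₂ : Reach p q b c) : Reach p q a c := by
  obtain ⟨d, l, r, rfl, rfl, hl, hr⟩ := h₁
  obtain ⟨d', l', r', hb, rfl, hl', hr'⟩ := h₂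
  rcases List.append_eq_append_iff.1 hb with ⟨t, rfl, rfl⟩ | ⟨t, rfl, rfl⟩
  · refine ⟨d', l ++ t, r', by simp, rfl, fun s hs => ?_, hr'⟩
    exact (List.mem_append.1 hs).elim (hl s) fun h => hl' s (List.mem_append_right _ h)
  · refine ⟨d, l, r' ++ t, rfl, by simp, hl, fun s hs => ?_⟩
    exact (List.mem_append.1 hs).elim (hr' s) fun h => hr s (List.mem_append_right _ h)

theorem reach_cons {s : α} (h : q s) : Reach p q a (s :: a) :=
  ⟨a, [], [s], rfl, rfl, by simp, by simpa using h⟩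

/-- The longest common suffix decides reachability for all pairs of predicates at once. -/
theorem exists_decomposition (a b : List α) :
    ∃ c l r, a = l ++ c ∧ b = r ++ c ∧
      ∀ p q : α → Prop, Reach p q a b ↔ (∀ s ∈ l, p s) ∧ ∀ s ∈ r, q s := by
  classical
  obtain ⟨c, hc, hmax⟩ := Finset.exists_max_image (a.tails.toFinset.filter fun c => c <:+ b)
    List.length ⟨[], by simp⟩
  simp only [Finset.mem_filter, List.mem_toFinset, List.mem_tails] at hc hmax
  obtain ⟨⟨l, hl⟩, ⟨r, hr⟩⟩ := hc
  refine ⟨c, l, r, hl.symm, hr.symm, fun p q => ⟨?_, fun h => ⟨c, l, r, hl.symm, hr.symm, h⟩⟩⟩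
  rintro ⟨c', l', r', ha, hb, hl', hr'⟩
  have hlen := hmax c' ⟨⟨l', ha.symm⟩, ⟨r', hb.symm⟩⟩
  obtain ⟨t, rfl⟩ := List.suffix_of_suffix_length_le ⟨l', ha.symm⟩ ⟨l, hl⟩ hlen
  rw [← hl, ← List.append_assoc, List.append_cancel_right_eq] at ha
  rw [← hr, ← List.append_assoc, List.append_cancel_right_eq] at hb
  subst ha hb
  exact ⟨fun s hs => hl' s (List.mem_append_left _ hs),
    fun s hs => hr' s (List.mem_append_left _ hs)⟩

theorem reach_cons_self_iff {s : α} : Reach p q (s :: a) a ↔ p s := by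
  refine ⟨?_, fun h => ⟨a, [s], [], rfl, rfl, by simpa using h, by simp⟩⟩
  rintro ⟨c, l, r, ha, rfl, hl, -⟩
  cases l with
  | nil =>
    have := congrArg List.length ha
    simp only [List.length_cons, List.length_append, List.length_nil] at this
    omega
  | cons t l =>
    obtain ⟨rfl, -⟩ := List.cons.inj ha
    exact hl _ List.mem_cons_self

end Reach

/-! ### The tree of canonical paths -/

/-- An edge of the tree with the world at its lower end. -/
structure Step (L : Vocabulary.{u, v}) where
  X : Finset L.Var
  Y : Finset L.Var
  Z : Finset L.Var
  world : Set (Formula L)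

section Tree

variable {w₀ : Set (Formula L)} {X Y Z : Finset L.Var}

/-- The world in which a path from `w₀` ends; the last step is the head of the list. -/
def endpoint (w₀ : Set (Formula L)) : List (Step L) → Set (Formula L)
  | [] => w₀
  | s :: _ => s.world

/-- Paths whose edges satisfy `Canon X Y Z` downwards and `Canon X Y ∅` upwards. -/
def IsPath (w₀ : Set (Formula L)) : List (Step L) → Prop
  | [] => True
  | s :: l => IsMCS s.world ∧ Disjoint s.Y s.Z ∧ Canon s.X s.Y s.Z (endpoint w₀ l) s.world ∧
      Canon s.X s.Y ∅ s.world (endpoint w₀ l) ∧ IsPath w₀ l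

/-- The edge `s` lies within a class of `∼_x`. -/
def Step.Sim (x : L.Var) (s : Step L) : Prop := Formula.dep s.X x ∈ s.world

theorem IsPath.endpoint_mcs (h₀ : IsMCS w₀) {a : List (Step L)} (ha : IsPath w₀ a) :
    IsMCS (endpoint w₀ a) := by
  cases a with
  | nil => exact h₀
  | cons s l => exact ha.1

theorem IsPath.of_append {l c : List (Step L)} (h : IsPath w₀ (l ++ c)) : IsPath w₀ c := by
  induction l with
  | nil => exact h
  | cons s l ih => exact ih h.2.2.2.2

theorem IsPath.canon_up (h₀ : IsMCS w₀) {l c : List (Step L)} (h : IsPath w₀ (l ++ c))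
    (hX : ∀ s ∈ l, ∀ x ∈ X, s.Sim x) (hY : ∀ s ∈ l, Y ⊆ s.Y) :
    Canon X Y ∅ (endpoint w₀ (l ++ c)) (endpoint w₀ c) := by
  classical
  induction l with
  | nil => exact canon_refl (h.endpoint_mcs h₀)
  | cons s l ih =>
    obtain ⟨hs, -, -, hup, hl⟩ := h
    simp only [List.forall_mem_cons] at hX hY
    have h₁ : Canon X Y ∅ s.world (endpoint w₀ (l ++ c)) :=
      (hup.of_dep hs hX.1).mono hs subset_rfl hY.1 subset_rfl
    have h₂ := h₁.trans hs (hl.endpoint_mcs h₀) (hl.of_append.endpoint_mcs h₀)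
      (Finset.empty_subset _) (Finset.empty_subset _) (ih hl hX.2 hY.2)
    rwa [Finset.union_empty] at h₂

theorem IsPath.sim_parent {s : Step L} {a : List (Step L)} (h : IsPath w₀ (s :: a)) {x : L.Var}
    (hx : s.Sim x) : Formula.dep s.X x ∈ endpoint w₀ a :=
  h.2.2.2.1.atom h.1 (dep_mem_atom _ _) hx

open scoped Classical in
theorem IsPath.canon_down (h₀ : IsMCS w₀) {r c : List (Step L)} (h : IsPath w₀ (r ++ c))
    (hX : ∀ s ∈ r, ∀ x ∈ X, s.Sim x) (hY : ∀ s ∈ r, Y ⊆ s.Y ∪ s.Z) :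
    Canon X Y (Y.filter fun y => ∃ s ∈ r, y ∈ s.Z) (endpoint w₀ c) (endpoint w₀ (r ++ c)) := by
  induction r with
  | nil => simpa using canon_refl (X := X) (Y := Y) (h.endpoint_mcs h₀)
  | cons s r ih =>
    have hpath : IsPath w₀ (s :: (r ++ c)) := h
    obtain ⟨hs, -, hdown, -, hr⟩ := h
    simp only [List.forall_mem_cons] at hX hY
    have hp := hr.endpoint_mcs h₀
    have h₁ : Canon X Y (Y.filter (· ∈ s.Z)) (endpoint w₀ (r ++ c)) s.world :=
      ((hdown.union_strict hp hs).of_dep hp fun x hx => hpath.sim_parent (hX.1 x hx)).mono hp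
        subset_rfl hY.1 fun y hy => (Finset.mem_filter.1 hy).2
    refine ((ih hr hX.2 hY.2).trans (hr.of_append.endpoint_mcs h₀) hp hs (Finset.filter_subset _ _)
      (Finset.filter_subset _ _) h₁).mono (hr.of_append.endpoint_mcs h₀) subset_rfl subset_rfl ?_
    intro y hy
    simp only [Finset.mem_filter, Finset.mem_union, List.exists_mem_cons_iff] at hy ⊢
    exact hy.2.elim (fun h => .inr ⟨hy.1, h⟩) fun h => .inl ⟨hy.1, h⟩

theorem IsPath.sim_of_dep_up (h₀ : IsMCS w₀) {l c : List (Step L)} (h : IsPath w₀ (l ++ c))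
    (hX : ∀ s ∈ l, ∀ x ∈ X, s.Sim x) {y : L.Var}
    (hy : Formula.dep X y ∈ endpoint w₀ (l ++ c)) : ∀ s ∈ l, s.Sim y := by
  induction l with
  | nil => simp
  | cons s l ih =>
    have hup : Canon X ∅ ∅ s.world (endpoint w₀ (l ++ c)) :=
      IsPath.canon_up (l := [s]) h₀ h (fun t ht => hX t (by simp_all)) (by simp)
    simp only [List.forall_mem_cons] at hX ⊢
    exact ⟨h.1.dep_trans hX.1 hy,
      ih h.2.2.2.2 hX.2 (hup.atom h.1 (dep_mem_atom _ _) hy)⟩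

theorem IsPath.sim_of_dep_down (h₀ : IsMCS w₀) {r c : List (Step L)} (h : IsPath w₀ (r ++ c))
    (hX : ∀ s ∈ r, ∀ x ∈ X, s.Sim x) {y : L.Var}
    (hy : Formula.dep X y ∈ endpoint w₀ c) : ∀ s ∈ r, s.Sim y := by
  induction r with
  | nil => simp
  | cons s r ih =>
    have hy' : Formula.dep X y ∈ endpoint w₀ (s :: r ++ c) :=
      (h.canon_down (Y := ∅) h₀ hX (by simp)).atom (h.of_append.endpoint_mcs h₀)
        (dep_mem_atom _ _) hy
    simp only [List.forall_mem_cons] at hX ⊢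
    exact ⟨h.1.dep_trans hX.1 hy', ih h.2.2.2.2 hX.2⟩

/-- The RPD-model on the paths from `w₀`. -/
def treeModel (w₀ : Set (Formula L)) (h₀ : IsMCS w₀) : RPDModel.{u, v, max u v} L where
  W := {a : List (Step L) // IsPath w₀ a}
  nonempty := ⟨⟨[], trivial⟩⟩
  sim x a b := Reach (Step.Sim x) (Step.Sim x) a.1 b.1
  sim_equiv x := ⟨fun _ => .refl, .symm, .trans⟩
  le y a b := Reach (fun s => y ∈ s.Y) (fun s => y ∈ s.Y ∨ y ∈ s.Z) a.1 b.1
  le_refl _ _ := .refl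
  le_trans _ _ _ _ := .trans
  val P x := {a | Formula.pred P x ∈ endpoint w₀ a.1}
  val_iff P x a b h := by
    classical
    have key : ∀ a b : {a : List (Step L) // IsPath w₀ a},
        (∀ i, Reach (Step.Sim (x i)) (Step.Sim (x i)) a.1 b.1) →
        Formula.pred P x ∈ endpoint w₀ a.1 → Formula.pred P x ∈ endpoint w₀ b.1 := by
      rintro ⟨a, ha⟩ ⟨b, hb⟩ h hP
      obtain ⟨c, l, r, rfl, rfl, hlr⟩ := exists_decomposition a b
      simp only [hlr] at h
      have hat : Formula.pred P x ∈ Atom (Finset.univ.image x) :=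
        .inl ⟨P, x, fun i => by simp, rfl⟩
      have h₁ := (ha.canon_up (X := Finset.univ.image x) (Y := ∅) h₀
        (by simpa using fun s hs i => (h i).1 s hs) (by simp)).atom (ha.endpoint_mcs h₀) hat hP
      exact (hb.canon_down (X := Finset.univ.image x) (Y := ∅) h₀
        (by simpa using fun s hs i => (h i).2 s hs) (by simp)).atom
          (ha.of_append.endpoint_mcs h₀) hat h₁
    exact ⟨key a b h, key b a fun i => (h i).symm⟩

variable (h₀ : IsMCS w₀)

/-- The relations of the tree are contained in the canonical ones. -/
theorem canon_of_R {a b : (treeModel w₀ h₀).W} (h : (treeModel w₀ h₀).R X Y Z a b) :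
    Canon X Y Z (endpoint w₀ a.1) (endpoint w₀ b.1) := by
  classical
  obtain ⟨a, ha⟩ := a
  obtain ⟨b, hb⟩ := b
  obtain ⟨hX, hY, hZ⟩ := h
  obtain ⟨c, l, r, rfl, rfl, hlr⟩ := exists_decomposition a b
  have hX' : ∀ x ∈ X, _ := fun x hx => (hlr _ _).1 (hX x hx)
  have hYZ : ∀ y ∈ Y ∪ Z, _ := fun y hy => (hlr _ _).1
    ((Finset.mem_union.1 hy).elim (hY y) fun h => (hZ y h).1)
  have h₁ : Canon X (Y ∪ Z) ∅ (endpoint w₀ (l ++ c)) (endpoint w₀ c) :=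
    ha.canon_up h₀ (fun s hs x hx => (hX' x hx).1 s hs) fun s hs y hy => (hYZ y hy).1 s hs
  have h₂ := hb.canon_down (X := X) (Y := Y ∪ Z) h₀ (fun s hs x hx => (hX' x hx).2 s hs)
    fun s hs y hy => Finset.mem_union.2 ((hYZ y hy).2 s hs)
  refine (h₁.trans (ha.endpoint_mcs h₀) (ha.of_append.endpoint_mcs h₀) (hb.endpoint_mcs h₀)
    (Finset.empty_subset _) (Finset.filter_subset _ _) h₂).mono (ha.endpoint_mcs h₀) subset_rfl
    Finset.subset_union_left fun z hz => ?_
  have hz' := hYZ z (Finset.mem_union_right _ hz)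
  -- A walk that cannot be reversed for `z` goes down an edge that is strict for `z`.
  have : ∃ s ∈ r, z ∈ s.Z := by
    by_contra! hno
    exact (hZ z hz).2 ((hlr _ _).2 ⟨fun s hs => .inl (hz'.1 s hs),
      fun s hs => (hz'.2 s hs).resolve_right (hno s hs)⟩).symm
  simp [hz, this]

/-- The truth lemma. -/
theorem sat_treeModel (φ : Formula L) (a : (treeModel w₀ h₀).W) :
    (treeModel w₀ h₀).Sat a φ ↔ φ ∈ endpoint w₀ a.1 := by
  induction φ generalizing a with
  | pred P x => exact Iff.rfl
  | neg φ ih => exact (not_congr (ih a)).trans (a.2.endpoint_mcs h₀).neg_mem.symm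
  | and φ ψ ih₁ ih₂ =>
    exact (and_congr (ih₁ a) (ih₂ a)).trans (a.2.endpoint_mcs h₀).and_mem.symm
  | dep X y =>
    obtain ⟨a, ha⟩ := a
    have hm := ha.endpoint_mcs h₀
    refine ⟨fun h => ?_, ?_⟩
    · have hpath : IsPath w₀ (⟨X, ∅, ∅, endpoint w₀ a⟩ :: a) :=
        ⟨hm, by simp, canon_refl hm, canon_refl hm, ha⟩
      have : Reach (Step.Sim y) (Step.Sim y) a _ :=
        h ⟨_, hpath⟩ fun x hx => reach_cons (hm.dep_self x hx)
      exact (reach_cons_self_iff (p := Step.Sim y)).1 this.symm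
    · rintro hy ⟨b, hb⟩ hX
      obtain ⟨c, l, r, rfl, rfl, hlr⟩ := exists_decomposition a b
      have hX' : ∀ x ∈ X, _ := fun x hx => (hlr _ _).1 (hX x hx)
      have hup := ha.canon_up (X := X) (Y := ∅) h₀ (fun s hs x hx => (hX' x hx).1 s hs) (by simp)
      exact (hlr _ _).2 ⟨ha.sim_of_dep_up h₀ (fun s hs x hx => (hX' x hx).1 s hs) hy,
        hb.sim_of_dep_down h₀ (fun s hs x hx => (hX' x hx).2 s hs)
          (hup.atom hm (dep_mem_atom _ _) hy)⟩
  | box X Y Z φ ih =>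
    have hm := a.2.endpoint_mcs h₀
    refine ⟨fun h => ?_, fun h b hab => (ih b).2 (canon_of_R h₀ hab φ h)⟩
    classical
    by_contra hbox
    obtain ⟨Y', Z', T, hT, hYZ, hZ, hdis, hdown, hup, hφ⟩ :=
      exists_edge hm (hm.dia_neg_mem.2 hbox)
    have hpath : IsPath w₀ (⟨X, Y', Z', T⟩ :: a.1) := ⟨hT, hdis, hdown, hup, a.2⟩
    have hmem : ∀ y ∈ Y ∪ Z, y ∈ Y' ∨ y ∈ Z' := fun y hy => by
      rwa [← hYZ, Finset.mem_union] at hy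
    refine hT.neg_mem.1 hφ ((ih ⟨_, hpath⟩).1 (h ⟨_, hpath⟩ ⟨fun x hx => ?_, fun y hy => ?_,
      fun z hz => ⟨?_, fun h' => ?_⟩⟩))
    · exact reach_cons (hT.dep_self x hx)
    · exact reach_cons (hmem y (Finset.mem_union_left _ hy))
    · exact reach_cons (hmem z (Finset.mem_union_right _ hz))
    · exact Finset.disjoint_right.1 hdis (hZ hz)
        ((reach_cons_self_iff (p := fun s : Step L => z ∈ s.Y)).1 h')

end Tree

/-! ### From relational models to assignments -/

namespace RPDModel

variable (M : RPDModel.{u, v, w} L)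

/-- The model in which `∼_z` is replaced by equality. -/
def separate (z : L.Var) : RPDModel.{u, v, w} L where
  W := M.W
  nonempty := M.nonempty
  sim x a b := M.sim x a b ∧ (x = z → a = b)
  sim_equiv x :=
    ⟨fun _ => ⟨(M.sim_equiv x).refl _, fun _ => rfl⟩,
      fun h => ⟨(M.sim_equiv x).symm h.1, fun e => (h.2 e).symm⟩,
      fun h h' => ⟨(M.sim_equiv x).trans h.1 h'.1, fun e => (h.2 e).trans (h'.2 e)⟩⟩
  le := M.le
  le_refl := M.le_refl
  le_trans := M.le_trans
  val := M.val
  val_iff P x a b h := M.val_iff P x a b fun i => (h i).1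

theorem sat_separate {z : L.Var} {φ : Formula L} (h : ¬ φ.Occurs z) (a : M.W) :
    (M.separate z).Sat a φ ↔ M.Sat a φ := by
  have hsim : ∀ {x : L.Var} {b c : M.W}, x ≠ z → ((M.separate z).sim x b c ↔ M.sim x b c) :=
    fun hx => and_iff_left fun e => absurd e hx
  induction φ generalizing a with
  | pred P x => exact Iff.rfl
  | neg φ ih => exact not_congr (ih h a)
  | and φ ψ ih₁ ih₂ =>
    exact and_congr (ih₁ (fun h' => h (.inl h')) a) (ih₂ (fun h' => h (.inr h')) a)
  | dep X y =>
    have hX : ∀ x ∈ X, x ≠ z := fun x hx e => h (.inl (e ▸ hx))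
    exact forall_congr' fun b => imp_congr (forall₂_congr fun x hx => hsim (hX x hx))
      (hsim fun e => h (.inr e.symm))
  | box X Y Z φ ih =>
    have hX : ∀ x ∈ X, x ≠ z := fun x hx e => h (.inl (e ▸ hx))
    exact forall_congr' fun b => imp_congr
      (and_congr (forall₂_congr fun x hx => hsim (hX x hx)) Iff.rfl)
      (ih (fun h' => h (.inr (.inr (.inr h')))) b)

/-- The assignment of a point: `x` is sent to the `∼_x`-class of the point, tagged with `x` so that
values of distinct variables are distinct objects. -/
def assignment (a : M.W) (x : L.Var) :
    Σ x : L.Var, Quotient (⟨M.sim x, M.sim_equiv x⟩ : Setoid M.W) :=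
  ⟨x, Quotient.mk _ a⟩

theorem assignment_eq_iff {a b : M.W} {x y : L.Var} :
    M.assignment a x = M.assignment b y ↔ x = y ∧ M.sim x a b := by
  constructor
  · intro h
    obtain rfl : x = y := congrArg Sigma.fst h
    exact ⟨rfl, Quotient.exact (eq_of_heq (Sigma.mk.inj h).2)⟩
  · rintro ⟨rfl, h⟩
    exact congrArg (Sigma.mk x) (Quotient.sound h)

/-- The PD-model whose admissible assignments are those of the points. An assignment may come from
several points, and the preferences are read off chosen ones. -/
noncomputable def toPD : PDModel.{u, v, max u w} L where
  O := Σ x : L.Var, Quotient (⟨M.sim x, M.sim_equiv x⟩ : Setoid M.W)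
  nonempty := ⟨M.assignment M.nonempty.some L.nonempty_var.some⟩
  I P := {o | ∃ (a : M.W) (x : Fin (L.ar P) → L.Var), a ∈ M.val P x ∧
    o = fun i => M.assignment a (x i)}
  A := Set.range M.assignment
  le x a b := M.le x a.2.choose b.2.choose
  le_refl _ _ := M.le_refl _ _
  le_trans _ _ _ _ := M.le_trans _ _ _ _

theorem sat_toPD (hM : Function.Injective M.assignment) (φ : Formula L) (a : M.W) :
    M.toPD.Sat ⟨M.assignment a, a, rfl⟩ φ ↔ M.Sat a φ := by
  have hle : ∀ (x : L.Var) (a b : M.W),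
      M.toPD.le x ⟨M.assignment a, a, rfl⟩ ⟨M.assignment b, b, rfl⟩ ↔ M.le x a b := by
    intro x a b
    have hch : ∀ (c : M.W) (h : ∃ d, M.assignment d = M.assignment c), h.choose = c :=
      fun c h => hM h.choose_spec
    exact iff_of_eq (congrArg₂ (M.le x) (hch a _) (hch b _))
  have hsim : ∀ (x : L.Var) (a b : M.W),
      M.assignment a x = M.assignment b x ↔ M.sim x a b := fun x a b => by
    simp [M.assignment_eq_iff]
  induction φ generalizing a with
  | pred P x =>
    refine ⟨?_, fun h => ⟨a, x, h, rfl⟩⟩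
    rintro ⟨b, y, hb, h⟩
    have h' : ∀ i, x i = y i ∧ M.sim (x i) a b := fun i => M.assignment_eq_iff.1 (congrFun h i)
    obtain rfl : x = y := funext fun i => (h' i).1
    exact (M.val_iff P x a b fun i => (h' i).2).2 hb
  | neg φ ih => exact not_congr (ih a)
  | and φ ψ ih₁ ih₂ => exact and_congr (ih₁ a) (ih₂ a)
  | dep X y =>
    refine ⟨fun h b hX => ?_, ?_⟩
    · exact (hsim y a b).1 (h ⟨_, b, rfl⟩ fun x hx => (hsim x a b).2 (hX x hx))
    · rintro h ⟨_, b, rfl⟩ hX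
      exact (hsim y a b).2 (h b fun x hx => (hsim x a b).1 (hX x hx))
  | box X Y Z φ ih =>
    have hlt : ∀ (x : L.Var) (a b : M.W),
        M.toPD.lt x ⟨M.assignment a, a, rfl⟩ ⟨M.assignment b, b, rfl⟩ ↔ M.lt x a b :=
      fun x a b => and_congr (hle x a b) (not_congr (hle x b a))
    refine ⟨fun h b hR => ?_, ?_⟩
    · exact (ih b).1 (h ⟨_, b, rfl⟩ (fun x hx => (hsim x a b).2 (hR.1 x hx))
        (fun y hy => (hle y a b).2 (hR.2.1 y hy)) fun z hz => (hlt z a b).2 (hR.2.2 z hz))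
    · rintro h ⟨_, b, rfl⟩ hX hY hZ
      exact (ih b).2 (h b ⟨fun x hx => (hsim x a b).1 (hX x hx),
        fun y hy => (hle y a b).1 (hY y hy), fun z hz => (hlt z a b).1 (hZ z hz)⟩)

end RPDModel

end LPFD

theorem mainTheorem1 (L : LPFD.Vocabulary) (Γ : Set (LPFD.Formula L))
    (hΓ : LPFD.Consistent Γ) :
    LPFD.SatisfiableRPD Γ ∧
      ((∃ z : L.Var, ∀ φ ∈ Γ, ¬ LPFD.Formula.Occurs z φ) → LPFD.SatisfiablePD Γ) := by
  obtain ⟨S, hΓS, hS⟩ := hΓ.exists_isMCS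
  let M := LPFD.treeModel S hS
  let root : M.W := ⟨[], trivial⟩
  have hroot : ∀ φ ∈ Γ, M.Sat root φ := fun φ hφ =>
    (LPFD.sat_treeModel hS φ root).2 (hΓS hφ)
  refine ⟨⟨M, root, hroot⟩, ?_⟩
  rintro ⟨z, hz⟩
  have hinj : Function.Injective (M.separate z).assignment := fun a b h =>
    ((M.separate z).assignment_eq_iff.1 (congrFun h z)).2.2 rfl
  exact ⟨(M.separate z).toPD, ⟨_, root, rfl⟩, fun φ hφ =>
    ((M.separate z).sat_toPD hinj φ root).2 ((M.sat_separate (hz φ hφ) root).2 (hroot φ hφ))⟩
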